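/- Let $m\ge 0$, $n\ge 1$, let $P\in\mathbb{R}^{n\times n}$ be symmetric positive definite with smallest and largest eigenvalues $\underline\lambda(P)$, $\overline\lambda(P)$, let $\|x\|_P=\sqrt{x^\top Px}$, let $\|\cdot\|$ be the Euclidean norm and $\mathbb{B}$ the closed unit ball. For a closed set $C\subseteq\mathbb{R}^k$ and $x\in C$, let $T_C(x)$ be the set of all $w=\lim_i (x_i-x)/t_i$ with $x_i\in C$, $x_i\to x$, $t_i>0$, $t_i\to0$, and let $N_C(x)=\{\eta\mid \eta^\top v\le 0\ \forall v\in T_C(x)\}$. For a symmetric positive definite matrix $Q$ put $\Pi_C^Q(x,v)=\operatorname{argmin}_{\mu\in T_C(x)}\|\mu-v\|_Q^2$, and for $d\ge 0$ put $\mathrm{N}_C^Q(x,v,d)=v-\big(Q^{-1}N_C(x)\cap d\,\mathbb{B}\big)$. Let $h:\mathbb{R}^n\to\mathbb{R}$ be continuously differentiable with $\nabla h$ locally Lipschitz and $\nabla h(x)\ne 0$ whenever $h(x)=0$. Assume that $\mathcal{S}=\{x\mid h(x)\ge 0\}$ is nonempty and compact, let $L_{\nabla h}$ be a Lipschitz constant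 of $\nabla h$ on $\mathcal{S}$, and let $\gamma:[0,\infty)\to\mathbb{R}$ be continuous and strictly increasing with $\gamma(0)=0$, $\lim_{a\to\infty}\gamma(a)=\infty$, and $d(x,\partial\mathcal{S})\le\gamma(h(x))$ for all $x\in\mathcal{S}$. Let $f:\mathbb{R}^m\times\mathbb{R}^n\to\mathbb{R}^n$ be locally Lipschitz, $g:\mathbb{R}^m\times\mathbb{R}^n\to\mathbb{R}^m$, $\mathcal{Z}\subset\mathbb{R}^m$ compact, and $\mathcal{L}_fh(z,x)=\nabla h(x)^\top f(z,x)$. Put $M_1=\min_{x\in\partial\mathcal{S}}\|\nabla h(x)\|$, let $0<\epsilon<M_1$, and, when $\mathcal{Z}\neq\emptyset$, define $$\alpha_*=\frac{\max_{\mathcal{Z}\times\mathcal{S}}|\mathcal{L}_fh|}{\gamma^{-1}\big((M_1-\epsilon)/L_{\nabla h}\big)},\qquad \delta=\max_{(z,x)\in\mathcal{Z}\times\mathcal{S}}\Big(1+\frac{L_{\nabla h}\,\gamma\big(\tfrac1{\alpha_*}|\mathcal{L}_fh(z,x)|\big)}{M_1}\Big)\frac{\overline\lambda(P)}{\underline\lambda(P)}\|f(z,x)\|,$$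 where $\tfrac1{\alpha_*}|\mathcal{L}_fh(z,x)|$ is read as $0$ if $\alpha_*=0$ (that is, if $\mathcal{L}_fh\equiv0$ on $\mathcal{Z}\times\mathcal{S}$). Consider the projected dynamical system (PDS) $$\begin{bmatrix}\dot\zeta\\ \dot\xi\end{bmatrix}\in\Pi^{\tilde P}_{\mathbb{R}^m\times\mathcal{S}}\Big((\zeta,\xi),\begin{bmatrix}g(\zeta,\xi)\\ f(\zeta,\xi)\end{bmatrix}\Big),\qquad \tilde P=\begin{bmatrix}I&0\\0&P\end{bmatrix},$$ and the differential inclusion (DI) $$\begin{bmatrix}\dot\zeta\\ \dot\xi\end{bmatrix}\in\begin{bmatrix}g(\zeta,\xi)\\ \mathrm{N}^P_{\mathcal{S}}(\xi,f(\zeta,\xi),\delta)\end{bmatrix},\qquad(\zeta,\xi)\in\mathbb{R}^m\times\mathcal{S}.$$ A solution on $[0,T]$ is an absolutely continuous function with the given initial value that satisfies the inclusion and the constraint for almost all $t\in[0,T]$. Let $(z_0,x_0)\in\mathcal{Z}\times\mathcal{S}$, $T\in[0,\infty)$, and let $\phi:[0,T]\to\mathbb{R}^m\times\mathbb{R}^n$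 satisfy $\phi(0)=(z_0,x_0)$ and $\phi(t)\in\mathcal{Z}\times\mathcal{S}$ for all $t\in[0,T]$. Then: 1. If $g$ is continuous, $\phi$ is a solution of the PDS if and only if it is a solution of the DI. 2. If $g$ is locally Lipschitz and $\phi$ is a solution of the PDS, then $\phi$ is also a solution of the DI, and every solution on $[0,T]$ of the PDS or of the DI with initial value $(z_0,x_0)$ coincides with $\phi$ on $[0,T]$. -/

import Mathlib

open Set Filter Topology MeasureTheory

noncomputable section

namespace ProjDyn

/-! ### Variational analysis and differential inclusions -/

/-- The tangent (Bouligand) cone `T_S(x)`.  For closed `S` it is empty when `x ∉ S`. -/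
def tangentCone {ι : Type*} [Fintype ι] (S : Set (EuclideanSpace ℝ ι)) (x : EuclideanSpace ℝ ι) :
    Set (EuclideanSpace ℝ ι) :=
  {w | ∃ (u : ℕ → EuclideanSpace ℝ ι) (t : ℕ → ℝ),
      (∀ i, u i ∈ S) ∧ (∀ i, 0 < t i) ∧ Tendsto u atTop (𝓝 x) ∧ Tendsto t atTop (𝓝 0) ∧
      Tendsto (fun i => (t i)⁻¹ • (u i - x)) atTop (𝓝 w)}

/-- The normal cone `N_S(x)`: the polar of the tangent cone. -/
def normalCone {ι : Type*} [Fintype ι] (S : Set (EuclideanSpace ℝ ι)) (x : EuclideanSpace ℝ ι) :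
    Set (EuclideanSpace ℝ ι) :=
  {η | ∀ v ∈ tangentCone S x, inner ℝ η v ≤ 0}

/-- The weighted norm `‖x‖_P = √(xᵀ P x)`. -/
def weightedNorm {ι : Type*} [Fintype ι] (P : Matrix ι ι ℝ) (x : EuclideanSpace ℝ ι) : ℝ :=
  Real.sqrt (x.ofLp ⬝ᵥ P.mulVec x.ofLp)

/-- The projection operator `Π_S^P(x, v) = argmin_{μ ∈ T_S(x)} ‖μ - v‖_P²`. -/
def projOp {ι : Type*} [Fintype ι] (P : Matrix ι ι ℝ) (S : Set (EuclideanSpace ℝ ι))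
    (x v : EuclideanSpace ℝ ι) : Set (EuclideanSpace ℝ ι) :=
  {μ | μ ∈ tangentCone S x ∧
      ∀ ν ∈ tangentCone S x, weightedNorm P (μ - v) ^ 2 ≤ weightedNorm P (ν - v) ^ 2}

/-- The map `N_S^P(x, v, d) = v - (P⁻¹ N_S(x) ∩ d𝔹)`. -/
def truncNormalMap {ι : Type*} [Fintype ι] [DecidableEq ι] (P : Matrix ι ι ℝ)
    (S : Set (EuclideanSpace ℝ ι)) (x v : EuclideanSpace ℝ ι) (d : ℝ) :
    Set (EuclideanSpace ℝ ι) :=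
  (fun w => v - w) ''
    (((fun η => WithLp.toLp 2 (P⁻¹.mulVec η.ofLp)) '' normalCone S x) ∩ Metric.closedBall 0 d)

/-- `φ`, restricted to `[0, T]`, is a Carathéodory solution of `ξ' ∈ F(ξ)`, `ξ ∈ C`, `ξ(0) = x₀`. -/
def IsSolution {X : Type*} [NormedAddCommGroup X] [NormedSpace ℝ X]
    (F : X → Set X) (C : Set X) (x₀ : X) (T : ℝ) (φ : ℝ → X) : Prop :=
  AbsolutelyContinuousOnInterval φ 0 T ∧ φ 0 = x₀ ∧
    ∀ᵐ t ∂(volume.restrict (Icc 0 T)), φ t ∈ C ∧ ∃ v ∈ F (φ t), HasDerivWithinAt φ v (Icc 0 T) t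

/-! ### The interconnection and the limiting differential inclusion -/

/-- The column vector `[z; x]`. -/
def stack {m n : ℕ} (w : EuclideanSpace ℝ (Fin m) × EuclideanSpace ℝ (Fin n)) :
    EuclideanSpace ℝ (Fin m ⊕ Fin n) :=
  WithLp.toLp 2 (Sum.elim w.1.ofLp w.2.ofLp)

/-- The block matrix `diag(I, P)`. -/
def blockWeight (m : ℕ) {n : ℕ} (P : Matrix (Fin n) (Fin n) ℝ) :
    Matrix (Fin m ⊕ Fin n) (Fin m ⊕ Fin n) ℝ :=
  Matrix.fromBlocks 1 0 0 P

/-- The right-hand side `Π_{ℝᵐ × S}^{diag(I, P)}((z, x), [g(z, x); f(z, x)])`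
of the interconnected projected dynamical system. -/
def pdsField {m n : ℕ} (P : Matrix (Fin n) (Fin n) ℝ) (S : Set (EuclideanSpace ℝ (Fin n)))
    (g : EuclideanSpace ℝ (Fin m) × EuclideanSpace ℝ (Fin n) → EuclideanSpace ℝ (Fin m))
    (f : EuclideanSpace ℝ (Fin m) × EuclideanSpace ℝ (Fin n) → EuclideanSpace ℝ (Fin n))
    (w : EuclideanSpace ℝ (Fin m) × EuclideanSpace ℝ (Fin n)) :
    Set (EuclideanSpace ℝ (Fin m) × EuclideanSpace ℝ (Fin n)) :=
  stack ⁻¹' projOp (blockWeight m P) (stack '' (univ ×ˢ S)) (stack w) (stack (g w, f w))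

/-- The right-hand side `[g(z, x); N_S^P(x, f(z, x), d)]` of the normal-cone inclusion. -/
def normalConeField {m n : ℕ} (P : Matrix (Fin n) (Fin n) ℝ) (S : Set (EuclideanSpace ℝ (Fin n)))
    (g : EuclideanSpace ℝ (Fin m) × EuclideanSpace ℝ (Fin n) → EuclideanSpace ℝ (Fin m))
    (f : EuclideanSpace ℝ (Fin m) × EuclideanSpace ℝ (Fin n) → EuclideanSpace ℝ (Fin n))
    (d : ℝ) (w : EuclideanSpace ℝ (Fin m) × EuclideanSpace ℝ (Fin n)) :
    Set (EuclideanSpace ℝ (Fin m) × EuclideanSpace ℝ (Fin n)) :=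
  {g w} ×ˢ truncNormalMap P S w.2 (f w) d

/-- Solutions on `[0, T]` of the interconnected projected dynamical system started at `w₀`. -/
def IsPDSSolution {m n : ℕ} (P : Matrix (Fin n) (Fin n) ℝ) (S : Set (EuclideanSpace ℝ (Fin n)))
    (g : EuclideanSpace ℝ (Fin m) × EuclideanSpace ℝ (Fin n) → EuclideanSpace ℝ (Fin m))
    (f : EuclideanSpace ℝ (Fin m) × EuclideanSpace ℝ (Fin n) → EuclideanSpace ℝ (Fin n))
    (w₀ : EuclideanSpace ℝ (Fin m) × EuclideanSpace ℝ (Fin n)) (T : ℝ)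
    (φ : ℝ → EuclideanSpace ℝ (Fin m) × EuclideanSpace ℝ (Fin n)) : Prop :=
  IsSolution (pdsField P S g f) univ w₀ T φ

/-- Solutions on `[0, T]` of the normal-cone inclusion with bound `d`, constrained to `ℝᵐ × S`
and started at `w₀`. -/
def IsNormalConeSolution {m n : ℕ} (P : Matrix (Fin n) (Fin n) ℝ)
    (S : Set (EuclideanSpace ℝ (Fin n)))
    (g : EuclideanSpace ℝ (Fin m) × EuclideanSpace ℝ (Fin n) → EuclideanSpace ℝ (Fin m))
    (f : EuclideanSpace ℝ (Fin m) × EuclideanSpace ℝ (Fin n) → EuclideanSpace ℝ (Fin n))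
    (d : ℝ) (w₀ : EuclideanSpace ℝ (Fin m) × EuclideanSpace ℝ (Fin n)) (T : ℝ)
    (φ : ℝ → EuclideanSpace ℝ (Fin m) × EuclideanSpace ℝ (Fin n)) : Prop :=
  IsSolution (normalConeField P S g f d) (univ ×ˢ S) w₀ T φ

/-! ### Constants -/

/-- Class `K_∞`; only the values of `γ` on `[0, ∞)` matter. -/
structure IsKInfty (γ : ℝ → ℝ) : Prop where
  continuousOn : ContinuousOn γ (Ici 0)
  map_zero : γ 0 = 0
  strictMonoOn : StrictMonoOn γ (Ici 0)
  tendsto_atTop : Tendsto γ atTop atTop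

/-- The set `{x | h(x) ≥ 0}`. -/
def safeSet {n : ℕ} (h : EuclideanSpace ℝ (Fin n) → ℝ) : Set (EuclideanSpace ℝ (Fin n)) :=
  {x | 0 ≤ h x}

/-- The Lie derivative `L_f h(z, x) = ∇h(x)ᵀ f(z, x)`. -/
def lieDeriv {m n : ℕ}
    (f : EuclideanSpace ℝ (Fin m) × EuclideanSpace ℝ (Fin n) → EuclideanSpace ℝ (Fin n))
    (h : EuclideanSpace ℝ (Fin n) → ℝ)
    (w : EuclideanSpace ℝ (Fin m) × EuclideanSpace ℝ (Fin n)) : ℝ :=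
  inner ℝ (gradient h w.2) (f w)

/-- Smallest eigenvalue of a symmetric matrix. -/
def lambdaMin {n : ℕ} (P : Matrix (Fin n) (Fin n) ℝ) : ℝ := sInf (spectrum ℝ P)

/-- Largest eigenvalue of a symmetric matrix. -/
def lambdaMax {n : ℕ} (P : Matrix (Fin n) (Fin n) ℝ) : ℝ := sSup (spectrum ℝ P)

/-- `M₁ = min_{x ∈ ∂S} ‖∇h(x)‖`. -/
def minBoundaryGrad {n : ℕ} (h : EuclideanSpace ℝ (Fin n) → ℝ) : ℝ :=
  sInf ((fun x => ‖gradient h x‖) '' frontier (safeSet h))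

/-- `α_* = max_{Z × S} |L_f h| / γ⁻¹((M₁ - ε) / L)`, with `γ⁻¹` the inverse of
`γ : [0, ∞) → [0, ∞)`. -/
def alphaStar {m n : ℕ}
    (f : EuclideanSpace ℝ (Fin m) × EuclideanSpace ℝ (Fin n) → EuclideanSpace ℝ (Fin n))
    (h : EuclideanSpace ℝ (Fin n) → ℝ) (Z : Set (EuclideanSpace ℝ (Fin m)))
    (γ : ℝ → ℝ) (L ε : ℝ) : ℝ :=
  sSup ((fun w => |lieDeriv f h w|) '' (Z ×ˢ safeSet h)) /
    Function.invFunOn γ (Ici 0) ((minBoundaryGrad h - ε) / L)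

/-- `δ = max_{Z × S} (1 + L γ(|L_f h| / α_*) / M₁) (λ_max(P) / λ_min(P)) ‖f‖`. -/
def deltaBound {m n : ℕ} (P : Matrix (Fin n) (Fin n) ℝ)
    (f : EuclideanSpace ℝ (Fin m) × EuclideanSpace ℝ (Fin n) → EuclideanSpace ℝ (Fin n))
    (h : EuclideanSpace ℝ (Fin n) → ℝ) (Z : Set (EuclideanSpace ℝ (Fin m)))
    (γ : ℝ → ℝ) (L ε : ℝ) : ℝ :=
  sSup ((fun w => (1 + L * γ (1 / alphaStar f h Z γ L ε * |lieDeriv f h w|) / minBoundaryGrad h) *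
      (lambdaMax P / lambdaMin P) * ‖f w‖) '' (Z ×ˢ safeSet h))

end ProjDyn

end

/-!
Both inclusions are compared with the one whose second component is `f - P⁻¹ N_S` with the *whole*
normal cone (`fullNormalConeField`).

At almost every time `t` a solution is differentiable at `t` and stays in the closed set `ℝᵐ × S`
on both sides of `t` (`ae_eventually_mem`), so its velocity `μ` and also `-μ` are tangent to `S`.
Hence `μ` is orthogonal to every normal (`inner_eq_zero_of_hasDerivAt`). This has two consequences
when `P (f - μ)` is a normal. By the Pythagorean identity for `⟨x, P y⟩`, the vector `μ` is the
projection of `f` on the tangent cone (`mem_projOp_of_normal`), and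
`‖f - μ‖ ≤ (λ_max(P) / λ_min(P)) ‖f‖` (`norm_sub_le_of_inner_eq_zero`), which is at most the
truncation radius on `Z × S` (`mul_norm_le_deltaBound`). Conversely, where `∇h ≠ 0` on the boundary
the tangent cone of `S` is a half-space, and the first variation of the projection shows that
`P (f - μ)` is a normal (`normal_of_mem_projOp`).

For uniqueness, a normal at a boundary point is a nonpositive multiple of `∇h`, so the descent
lemma for `h` gives `⟨η, y - x⟩ ≤ c ‖η‖ ‖y - x‖²` on `S` (`exists_inner_normal_le`). As the normals
along a solution are bounded, the squared `diag(I, P)`-norm `E` of the difference of two solutions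
satisfies `E' ≤ K E` almost everywhere (`two_mul_inner_sub_le`). It is absolutely continuous and
vanishes at `0`, so it vanishes identically by Grönwall's inequality (`nonpos_of_ae_hasDerivAt_le`).
-/

namespace ProjDyn

/-! ### The quadratic form of the weight matrix -/

section Weight

variable {ι : Type*} [Fintype ι] [DecidableEq ι] {P : Matrix ι ι ℝ}

/-- The continuous linear map `x ↦ P x` of Euclidean space. -/
noncomputable abbrev weightMap (P : Matrix ι ι ℝ) :
    EuclideanSpace ℝ ι →L[ℝ] EuclideanSpace ℝ ι :=
  Matrix.toEuclideanCLM (𝕜 := ℝ) P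

lemma inner_weightMap_comm (hP : P.IsHermitian) (x y : EuclideanSpace ℝ ι) :
    inner ℝ x (weightMap P y) = inner ℝ (weightMap P x) y :=
  ((Matrix.isSymmetric_toEuclideanLin_iff.2 hP) x y).symm

lemma inner_weightMap_self_nonneg (hP : P.PosSemidef) (x : EuclideanSpace ℝ ι) :
    0 ≤ inner ℝ x (weightMap P x) := by
  rw [Matrix.inner_toEuclideanCLM]
  simpa using hP.dotProduct_mulVec_nonneg x.ofLp

lemma weightedNorm_sq (hP : P.PosSemidef) (x : EuclideanSpace ℝ ι) :
    weightedNorm P x ^ 2 = inner ℝ x (weightMap P x) := by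
  have := inner_weightMap_self_nonneg hP x
  rw [Matrix.inner_toEuclideanCLM] at this ⊢
  exact Real.sq_sqrt this

lemma inner_weightMap_self_add (hP : P.IsHermitian) (x y : EuclideanSpace ℝ ι) :
    inner ℝ (x + y) (weightMap P (x + y)) =
      inner ℝ x (weightMap P x) + 2 * inner ℝ x (weightMap P y) +
        inner ℝ y (weightMap P y) := by
  have h := inner_weightMap_comm hP y x
  rw [real_inner_comm x] at h
  simp only [map_add, inner_add_left, inner_add_right]
  linarith

lemma inner_weightMap_self_eq_sum (hP : P.IsHermitian) (x : EuclideanSpace ℝ ι) :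
    inner ℝ x (weightMap P x) =
      ∑ i, hP.eigenvalues i * inner ℝ (hP.eigenvectorBasis i) x ^ 2 := by
  have key : ∀ i, weightMap P (hP.eigenvectorBasis i) =
      hP.eigenvalues i • hP.eigenvectorBasis i := fun i => by
    ext j
    simpa using congrFun (hP.mulVec_eigenvectorBasis i) j
  rw [← hP.eigenvectorBasis.sum_inner_mul_inner]
  refine Finset.sum_congr rfl fun i _ => ?_
  rw [inner_weightMap_comm hP, key, real_inner_smul_left, real_inner_comm]
  ring

end Weight

section Eigenvalues

variable {n : ℕ} {P : Matrix (Fin n) (Fin n) ℝ}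

lemma lambdaMin_le_eigenvalues (hP : P.IsHermitian) (i : Fin n) :
    lambdaMin P ≤ hP.eigenvalues i :=
  csInf_le P.finite_real_spectrum.bddBelow (hP.eigenvalues_mem_spectrum_real i)

lemma eigenvalues_le_lambdaMax (hP : P.IsHermitian) (i : Fin n) :
    hP.eigenvalues i ≤ lambdaMax P :=
  le_csSup P.finite_real_spectrum.bddAbove (hP.eigenvalues_mem_spectrum_real i)

lemma norm_sq_eq_sum (hP : P.IsHermitian) (x : EuclideanSpace ℝ (Fin n)) :
    ‖x‖ ^ 2 = ∑ i, inner ℝ (hP.eigenvectorBasis i) x ^ 2 := by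
  simpa using (hP.eigenvectorBasis.sum_sq_norm_inner_right x).symm

lemma lambdaMin_mul_norm_sq_le (hP : P.IsHermitian) (x : EuclideanSpace ℝ (Fin n)) :
    lambdaMin P * ‖x‖ ^ 2 ≤ inner ℝ x (weightMap P x) := by
  rw [inner_weightMap_self_eq_sum hP, norm_sq_eq_sum hP, Finset.mul_sum]
  gcongr with i
  exact lambdaMin_le_eigenvalues hP i

lemma le_lambdaMax_mul_norm_sq (hP : P.IsHermitian) (x : EuclideanSpace ℝ (Fin n)) :
    inner ℝ x (weightMap P x) ≤ lambdaMax P * ‖x‖ ^ 2 := by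
  rw [inner_weightMap_self_eq_sum hP, norm_sq_eq_sum hP, Finset.mul_sum]
  gcongr with i
  exact eigenvalues_le_lambdaMax hP i

lemma lambdaMin_pos [NeZero n] (hP : P.PosDef) : 0 < lambdaMin P := by
  have hne : (spectrum ℝ P).Nonempty := ⟨_, hP.1.eigenvalues_mem_spectrum_real 0⟩
  have hmem : lambdaMin P ∈ spectrum ℝ P := hne.csInf_mem P.finite_real_spectrum
  rw [hP.1.spectrum_real_eq_range_eigenvalues] at hmem
  obtain ⟨i, hi⟩ := hmem
  exact hi ▸ hP.eigenvalues_pos i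

lemma lambdaMin_le_lambdaMax [NeZero n] (hP : P.IsHermitian) : lambdaMin P ≤ lambdaMax P :=
  (lambdaMin_le_eigenvalues hP 0).trans (eigenvalues_le_lambdaMax hP 0)

/-- The Pythagorean identity for the `P`-orthogonal splitting `v = μ + (v - μ)` bounds the normal
part `v - μ` by the square root of the condition number `λ_max(P) / λ_min(P) ≥ 1`, which is at most
the condition number itself. -/
lemma norm_sub_le_of_inner_eq_zero [NeZero n] (hP : P.PosDef) {v μ : EuclideanSpace ℝ (Fin n)}
    (h : inner ℝ μ (weightMap P (v - μ)) = 0) :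
    ‖v - μ‖ ≤ lambdaMax P / lambdaMin P * ‖v‖ := by
  have h1 := inner_weightMap_self_add hP.1 μ (v - μ)
  rw [add_sub_cancel, h] at h1
  have h2 := inner_weightMap_self_nonneg hP.posSemidef μ
  have h3 := lambdaMin_mul_norm_sq_le hP.1 (v - μ)
  have h4 := le_lambdaMax_mul_norm_sq hP.1 v
  have hpos := lambdaMin_pos hP
  have hle := lambdaMin_le_lambdaMax hP.1
  have hκ : 1 ≤ lambdaMax P / lambdaMin P := (one_le_div hpos).2 hle
  have h5 : ‖v - μ‖ ^ 2 ≤ lambdaMax P / lambdaMin P * ‖v‖ ^ 2 := by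
    rw [div_mul_eq_mul_div, le_div_iff₀ hpos]
    linarith
  refine abs_le_of_sq_le_sq' ?_ (by positivity) |>.2
  nlinarith [sq_nonneg ‖v‖, mul_nonneg (sub_nonneg.2 hκ) (sq_nonneg ‖v‖)]

end Eigenvalues

/-! ### Product structure of the projected field -/

section Product

variable {m n : ℕ}

lemma stack_injective : Function.Injective (stack (m := m) (n := n)) := by
  intro a b hab
  have h : ∀ i, (stack a).ofLp i = (stack b).ofLp i := fun i => by rw [hab]
  ext i
  · exact h (.inl i)
  · exact h (.inr i)

lemma stack_sub (a b : EuclideanSpace ℝ (Fin m) × EuclideanSpace ℝ (Fin n)) :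
    stack a - stack b = stack (a - b) := by
  ext i
  cases i <;> simp [stack]

lemma stack_smul (c : ℝ) (a : EuclideanSpace ℝ (Fin m) × EuclideanSpace ℝ (Fin n)) :
    c • stack a = stack (c • a) := by
  ext i
  cases i <;> simp [stack]

lemma continuous_stack : Continuous (stack (m := m) (n := n)) := by
  refine (PiLp.continuous_toLp 2 _).comp (continuous_pi fun i => ?_)
  cases i <;> simp only [Sum.elim_inl, Sum.elim_inr] <;> fun_prop

/-- The inverse of `stack`. -/
def unstack (u : EuclideanSpace ℝ (Fin m ⊕ Fin n)) :
    EuclideanSpace ℝ (Fin m) × EuclideanSpace ℝ (Fin n) :=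
  (WithLp.toLp 2 fun i => u.ofLp (.inl i), WithLp.toLp 2 fun i => u.ofLp (.inr i))

lemma stack_unstack (u : EuclideanSpace ℝ (Fin m ⊕ Fin n)) : stack (unstack u) = u := by
  ext i
  cases i <;> simp [stack, unstack]

lemma unstack_stack (w : EuclideanSpace ℝ (Fin m) × EuclideanSpace ℝ (Fin n)) :
    unstack (stack w) = w :=
  stack_injective (stack_unstack _)

lemma continuous_unstack : Continuous (unstack (m := m) (n := n)) := by
  unfold unstack
  fun_prop

lemma stack_mem_tangentCone_iff {S : Set (EuclideanSpace ℝ (Fin n))}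
    {w v : EuclideanSpace ℝ (Fin m) × EuclideanSpace ℝ (Fin n)} :
    stack v ∈ tangentCone (stack '' (univ ×ˢ S)) (stack w) ↔ v.2 ∈ tangentCone S w.2 := by
  constructor
  · rintro ⟨u, t, hu, ht, hux, ht0, huv⟩
    choose p hp hpu using hu
    obtain rfl : (fun i => stack (p i)) = u := funext hpu
    refine ⟨fun i => (p i).2, t, fun i => (hp i).2, ht, ?_, ht0, ?_⟩
    · have := (continuous_unstack.tendsto _).comp hux
      simp only [Function.comp_def, unstack_stack] at this
      exact this.snd_nhds
    · have := (continuous_unstack.tendsto _).comp huv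
      simp only [Function.comp_def, stack_sub, stack_smul, unstack_stack] at this
      exact this.snd_nhds
  · rintro ⟨u, t, hu, ht, hux, ht0, huv⟩
    refine ⟨fun i => stack (w.1 + t i • v.1, u i), t, fun i => ⟨_, ⟨trivial, hu i⟩, rfl⟩, ht, ?_,
      ht0, ?_⟩
    · refine (continuous_stack.tendsto _).comp (Tendsto.prodMk_nhds ?_ hux)
      simpa using tendsto_const_nhds.add (ht0.smul_const v.1)
    · simp only [stack_sub, stack_smul]
      refine (continuous_stack.tendsto _).comp (Tendsto.prodMk_nhds ?_ huv)
      simp [smul_smul, inv_mul_cancel₀ (ht _).ne']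

lemma weightedNorm_stack_sq {P : Matrix (Fin n) (Fin n) ℝ} (hP : P.PosSemidef)
    (w : EuclideanSpace ℝ (Fin m) × EuclideanSpace ℝ (Fin n)) :
    weightedNorm (blockWeight m P) (stack w) ^ 2 = ‖w.1‖ ^ 2 + weightedNorm P w.2 ^ 2 := by
  have h1 : (stack w).ofLp ⬝ᵥ (blockWeight m P).mulVec (stack w).ofLp =
      ‖w.1‖ ^ 2 + w.2.ofLp ⬝ᵥ P.mulVec w.2.ofLp := by
    rw [blockWeight, Matrix.fromBlocks_mulVec]
    simp only [stack, Sum.elim_comp_inl, Sum.elim_comp_inr, sumElim_dotProduct_sumElim]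
    simp [EuclideanSpace.real_norm_sq_eq, dotProduct, ← sq]
  have h2 : 0 ≤ w.2.ofLp ⬝ᵥ P.mulVec w.2.ofLp := by
    simpa using hP.dotProduct_mulVec_nonneg w.2.ofLp
  rw [weightedNorm, weightedNorm, h1, Real.sq_sqrt h2, Real.sq_sqrt (by positivity)]

/-- Because the weight is block diagonal and `ℝᵐ × S` imposes no constraint on the first
component, the projection acts on the second component only. -/
lemma pdsField_eq {P : Matrix (Fin n) (Fin n) ℝ} (hP : P.PosSemidef)
    (S : Set (EuclideanSpace ℝ (Fin n)))
    (g : EuclideanSpace ℝ (Fin m) × EuclideanSpace ℝ (Fin n) → EuclideanSpace ℝ (Fin m))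
    (f : EuclideanSpace ℝ (Fin m) × EuclideanSpace ℝ (Fin n) → EuclideanSpace ℝ (Fin n))
    (w : EuclideanSpace ℝ (Fin m) × EuclideanSpace ℝ (Fin n)) :
    pdsField P S g f w = {g w} ×ˢ projOp P S w.2 (f w) := by
  ext v
  simp only [pdsField, projOp, mem_preimage, mem_ofPred_eq, stack_mem_tangentCone_iff,
    mem_prod, mem_singleton_iff]
  constructor
  · rintro ⟨hv, hmin⟩
    have hmin' : ∀ a, ∀ b ∈ tangentCone S w.2, ‖v.1 - g w‖ ^ 2 + weightedNorm P (v.2 - f w) ^ 2 ≤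
        ‖a - g w‖ ^ 2 + weightedNorm P (b - f w) ^ 2 := fun a b hb => by
      have := hmin (stack (a, b)) (stack_mem_tangentCone_iff.2 hb)
      simpa only [stack_sub, weightedNorm_stack_sq hP, Prod.fst_sub, Prod.snd_sub] using this
    have h1 : v.1 = g w := by
      have := hmin' (g w) v.2 hv
      rw [sub_self, norm_zero] at this
      have h0 : ‖v.1 - g w‖ = 0 := pow_eq_zero_iff two_ne_zero |>.1
        (le_antisymm (by linarith) (sq_nonneg _))
      exact sub_eq_zero.1 (norm_eq_zero.1 h0)
    refine ⟨h1, hv, fun b hb => ?_⟩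
    have := hmin' v.1 b hb
    linarith
  · rintro ⟨h1, hv, hmin⟩
    refine ⟨hv, fun u hu => ?_⟩
    rw [← stack_unstack u, stack_mem_tangentCone_iff] at hu
    rw [← stack_unstack u, stack_sub, stack_sub, weightedNorm_stack_sq hP,
      weightedNorm_stack_sq hP]
    have := hmin _ hu
    simp only [Prod.fst_sub, Prod.snd_sub, h1, sub_self, norm_zero]
    nlinarith [sq_nonneg ‖(unstack u).1 - g w‖]

end Product

/-! ### Tangent and normal cones of a superlevel set -/

section Cones

variable {ι : Type*} [Fintype ι]

lemma mem_closure_of_mem_tangentCone {S : Set (EuclideanSpace ℝ ι)} {x w : EuclideanSpace ℝ ι}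
    (hw : w ∈ tangentCone S x) : x ∈ closure S := by
  obtain ⟨u, t, hu, -, hux, -⟩ := hw
  exact mem_closure_of_tendsto hux (.of_forall hu)

/-- The velocity of a curve that stays in `S` to the right of `t` is tangent to `S`. -/
lemma mem_tangentCone_of_hasDerivAt {S : Set (EuclideanSpace ℝ ι)} {c : ℝ → EuclideanSpace ℝ ι}
    {v : EuclideanSpace ℝ ι} {t : ℝ} (hc : HasDerivAt c v t) (hS : ∀ᶠ s in 𝓝[>] t, c s ∈ S) :
    v ∈ tangentCone S (c t) := by
  obtain ⟨s, hs, hsS⟩ := exists_seq_forall_of_frequently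
    (hS.and self_mem_nhdsWithin).frequently
  have hs' : Tendsto s atTop (𝓝 t) := tendsto_nhds_of_tendsto_nhdsWithin hs
  refine ⟨fun i => c (s i), fun i => s i - t, fun i => (hsS i).1, fun i => sub_pos.2 (hsS i).2,
    (hc.continuousAt.tendsto).comp hs', by simpa using hs'.sub_const t, ?_⟩
  have := hasDerivAt_iff_tendsto_slope.1 hc
  refine this.comp (tendsto_nhdsWithin_iff.2 ⟨hs', .of_forall fun i => ?_⟩)
  exact (hsS i).2.ne'

/-- The velocity of a curve that stays in `S` on both sides of `t` is orthogonal to the normals. -/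
lemma inner_eq_zero_of_hasDerivAt {S : Set (EuclideanSpace ℝ ι)} {c : ℝ → EuclideanSpace ℝ ι}
    {v η : EuclideanSpace ℝ ι} {t : ℝ} (hc : HasDerivAt c v t) (hS : ∀ᶠ s in 𝓝 t, c s ∈ S)
    (hη : η ∈ normalCone S (c t)) : inner ℝ v η = 0 := by
  have h1 := hη _ (mem_tangentCone_of_hasDerivAt hc (hS.filter_mono nhdsWithin_le_nhds))
  have hc' : HasDerivAt (fun s => c (-s)) (-v) (-t) := by
    have : HasDerivAt c v (- -t) := by rwa [neg_neg]
    simpa using! this.scomp (-t) (hasDerivAt_neg (-t))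
  have hS' : ∀ᶠ s in 𝓝 (-t), c (-s) ∈ S :=
    (continuous_neg.tendsto' (-t) t (neg_neg t)).eventually hS
  have h2 := mem_tangentCone_of_hasDerivAt hc' (hS'.filter_mono nhdsWithin_le_nhds)
  rw [neg_neg] at h2
  have h3 := hη _ h2
  rw [inner_neg_right] at h3
  rw [real_inner_comm]
  linarith

variable {h : EuclideanSpace ℝ ι → ℝ} {x w η : EuclideanSpace ℝ ι}

lemma mem_tangentCone_of_pos (hh : Continuous h) (hx : 0 < h x) (w : EuclideanSpace ℝ ι) :
    w ∈ tangentCone {x | 0 ≤ h x} x := by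
  have hc : HasDerivAt (fun s : ℝ => x + s • w) w 0 := by
    simpa using ((hasDerivAt_id (0 : ℝ)).smul_const w).const_add x
  have hx0 : x = x + (0 : ℝ) • w := by simp
  have key : ∀ᶠ s in 𝓝 (0 : ℝ), 0 < h (x + s • w) :=
    (hh.comp (by fun_prop : Continuous fun s : ℝ => x + s • w)).continuousAt.eventually_const_lt
      (by simpa using hx)
  rw [hx0]
  exact mem_tangentCone_of_hasDerivAt hc
    ((key.mono fun s hs => hs.le).filter_mono nhdsWithin_le_nhds)

lemma mem_tangentCone_of_inner_gradient_pos (hh : DifferentiableAt ℝ h x) (hx : 0 ≤ h x)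
    (hw : 0 < inner ℝ (gradient h x) w) : w ∈ tangentCone {x | 0 ≤ h x} x := by
  have hx0 : x = x + (0 : ℝ) • w := by simp
  have hc : HasDerivAt (fun s : ℝ => x + s • w) w 0 := by
    simpa using ((hasDerivAt_id (0 : ℝ)).smul_const w).const_add x
  have hd : HasDerivAt (fun s : ℝ => h (x + s • w)) (inner ℝ (gradient h x) w) 0 := by
    rw [inner_gradient_left]
    have h1 := hh.hasFDerivAt
    rw [hx0] at h1
    simpa using! h1.comp_hasDerivAt (0 : ℝ) hc
  have key : ∀ᶠ s in 𝓝[>] (0 : ℝ), 0 < slope (fun s : ℝ => h (x + s • w)) 0 s :=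
    ((hasDerivAt_iff_tendsto_slope.1 hd).mono_left
      (nhdsWithin_mono _ fun s hs => (mem_Ioi.1 hs).ne')).eventually_const_lt hw
  rw [hx0]
  refine mem_tangentCone_of_hasDerivAt hc ?_
  filter_upwards [key, self_mem_nhdsWithin] with s hs hs0
  have hs0' : (0 : ℝ) < s := hs0
  rw [slope_def_field, sub_zero, zero_smul, add_zero, div_pos_iff_of_pos_right hs0'] at hs
  change 0 ≤ h (x + s • w)
  linarith

lemma inner_gradient_nonneg_of_mem_tangentCone (hh : DifferentiableAt ℝ h x) (hx : h x = 0)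
    (hw : w ∈ tangentCone {x | 0 ≤ h x} x) : 0 ≤ inner ℝ (gradient h x) w := by
  obtain ⟨u, t, hu, ht, hux, ht0, huw⟩ := hw
  have := (hasFDerivWithinAt_univ.2 hh.hasFDerivAt).lim (d := fun i => u i - x)
    (by simpa using hux.sub_const x) (by simp) huw
  rw [inner_gradient_left]
  refine ge_of_tendsto' this fun i => ?_
  simp only [add_sub_cancel, hx, sub_zero, smul_eq_mul]
  exact mul_nonneg (inv_nonneg.2 (ht i).le) (hu i)

/-- A nonzero normal to `{h ≥ 0}` exists only where the constraint is active, and there it is a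
nonpositive multiple of the gradient. -/
lemma exists_eq_neg_smul_gradient (hh : ContDiff ℝ 1 h)
    (h_regular : ∀ x, h x = 0 → gradient h x ≠ 0) (hx : 0 ≤ h x)
    (hη : η ∈ normalCone {x | 0 ≤ h x} x) (hη0 : η ≠ 0) :
    h x = 0 ∧ ∃ c : ℝ, 0 ≤ c ∧ η = -(c • gradient h x) := by
  have hd : DifferentiableAt ℝ h x := hh.differentiable one_ne_zero x
  have hx0 : h x = 0 := by
    by_contra hne
    have := hη η (mem_tangentCone_of_pos hh.continuous (lt_of_le_of_ne hx (Ne.symm hne)) η)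
    exact hη0 (real_inner_self_nonpos.1 this)
  set a := gradient h x with ha
  have ha0 : 0 < inner ℝ a a := real_inner_self_pos.2 (h_regular x hx0)
  have hηa : inner ℝ η a ≤ 0 := hη a (mem_tangentCone_of_inner_gradient_pos hd hx ha0)
  set c := -(inner ℝ η a / inner ℝ a a) with hc
  have hpa : inner ℝ (η + c • a) a = 0 := by
    rw [inner_add_left, real_inner_smul_left, hc]
    field_simp
    ring
  refine ⟨hx0, c, neg_nonneg.2 (div_nonpos_of_nonpos_of_nonneg hηa ha0.le), ?_⟩
  -- The component of `η` orthogonal to `a` is tangent after an arbitrarily small tilt along `a`.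
  have hp : ∀ s > (0 : ℝ), inner ℝ (η + c • a) (η + c • a) + s * inner ℝ η a ≤ 0 := fun s hs => by
    have h1 := hη (η + c • a + s • a) (mem_tangentCone_of_inner_gradient_pos hd hx (by
      rw [inner_add_right, real_inner_comm, hpa, real_inner_smul_right, zero_add]
      positivity))
    rw [inner_add_right, real_inner_smul_right] at h1
    rw [inner_add_left (𝕜 := ℝ) η, real_inner_smul_left, real_inner_comm (η + c • a) a, hpa]
    linarith
  have hlim : Tendsto (fun s : ℝ => inner ℝ (η + c • a) (η + c • a) + s * inner ℝ η a) (𝓝[>] 0)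
      (𝓝 (inner ℝ (η + c • a) (η + c • a))) := by
    have : Continuous fun s : ℝ => inner ℝ (η + c • a) (η + c • a) + s * inner ℝ η a := by fun_prop
    simpa using (this.tendsto 0).mono_left nhdsWithin_le_nhds
  have h0 := le_of_tendsto hlim (eventually_nhdsWithin_of_forall hp)
  exact eq_neg_of_add_eq_zero_left (real_inner_self_nonpos.1 h0)

/-- The descent lemma, uniformly over a compact set. -/
lemma exists_abs_sub_sub_inner_gradient_le (hh : Differentiable ℝ h)
    (h_grad : LocallyLipschitz (gradient h)) {S : Set (EuclideanSpace ℝ ι)} (hS : IsCompact S) :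
    ∃ K : ℝ, 0 ≤ K ∧ ∀ x ∈ S, ∀ y ∈ S,
      |h y - h x - inner ℝ (gradient h x) (y - x)| ≤ K * ‖y - x‖ ^ 2 := by
  obtain ⟨r, hr⟩ := hS.isBounded.subset_closedBall 0
  obtain ⟨K, hK⟩ := h_grad.locallyLipschitzOn.exists_lipschitzOnWith_of_compact
    (isCompact_closedBall (0 : EuclideanSpace ℝ ι) r)
  refine ⟨K, K.2, fun x hx y hy => ?_⟩
  have hseg : segment ℝ x y ⊆ Metric.closedBall 0 r :=
    (convex_closedBall _ _).segment_subset (hr hx) (hr hy)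
  have := (convex_segment x y).norm_image_sub_le_of_norm_hasFDerivWithin_le' (f := h)
    (f' := fderiv ℝ h) (φ := fderiv ℝ h x) (C := K * ‖y - x‖)
    (fun z _ => (hh z).hasFDerivAt.hasFDerivWithinAt) (fun z hz => ?_)
    (left_mem_segment ℝ x y) (right_mem_segment ℝ x y)
  · rw [← inner_gradient_left, Real.norm_eq_abs] at this
    linarith
  · rw [← toDual_gradient, ← toDual_gradient, ← map_sub, LinearIsometryEquiv.norm_map]
    refine (hK.norm_sub_le (hseg hz) (hr hx)).trans ?_
    gcongr
    exact norm_sub_le_of_mem_segment hz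

/-- Hypomonotonicity of the normal cones: a regular superlevel set with locally Lipschitz gradient
is prox-regular, uniformly over a compact set. -/
lemma exists_inner_normal_le (hh : ContDiff ℝ 1 h) (h_grad : LocallyLipschitz (gradient h))
    (h_regular : ∀ x, h x = 0 → gradient h x ≠ 0) (hS : IsCompact {x | 0 ≤ h x}) :
    ∃ c : ℝ, 0 ≤ c ∧ ∀ x ∈ {x | 0 ≤ h x}, ∀ y ∈ {x | 0 ≤ h x},
      ∀ η ∈ normalCone {x | 0 ≤ h x} x, inner ℝ η (y - x) ≤ c * ‖η‖ * ‖y - x‖ ^ 2 := by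
  obtain ⟨K, hK0, hK⟩ :=
    exists_abs_sub_sub_inner_gradient_le (hh.differentiable one_ne_zero) h_grad hS
  have hB : IsCompact {x | h x = 0} :=
    hS.of_isClosed_subset (isClosed_eq hh.continuous continuous_const) fun x hx => hx.ge
  obtain ⟨M, hM0, hM⟩ := hB.exists_forall_le' (f := fun x => ‖gradient h x‖) (a := 0)
    h_grad.continuous.norm.continuousOn fun x hx => norm_pos_iff.2 (h_regular x hx)
  refine ⟨K / M, by positivity, fun x hx y hy η hη => ?_⟩
  by_cases hη0 : η = 0
  · simp [hη0]
  obtain ⟨hx0, c, hc, hηc⟩ := exists_eq_neg_smul_gradient hh h_regular hx hη hη0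
  have h1 := (abs_le.1 (hK x hx y hy)).2
  have hy' : 0 ≤ h y := hy
  have h2 : -inner ℝ (gradient h x) (y - x) ≤ K * ‖y - x‖ ^ 2 := by linarith
  have h3 : c * M ≤ ‖η‖ := by
    rw [hηc, norm_neg, norm_smul, Real.norm_of_nonneg hc]
    gcongr
    exact hM x hx0
  have h4 : c ≤ ‖η‖ / M := (le_div_iff₀ hM0).2 h3
  calc inner ℝ η (y - x) = c * -inner ℝ (gradient h x) (y - x) := by
        rw [hηc, inner_neg_left, real_inner_smul_left]; ring
    _ ≤ c * (K * ‖y - x‖ ^ 2) := by gcongr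
    _ ≤ ‖η‖ / M * (K * ‖y - x‖ ^ 2) := by gcongr
    _ = K / M * ‖η‖ * ‖y - x‖ ^ 2 := by ring

end Cones

/-! ### Projections and normals -/

section Projection

variable {ι : Type*} [Fintype ι] [DecidableEq ι] {P : Matrix ι ι ℝ}

lemma mem_truncNormalMap_iff (hP : P.PosDef) {S : Set (EuclideanSpace ℝ ι)}
    {x v μ : EuclideanSpace ℝ ι} {d : ℝ} :
    μ ∈ truncNormalMap P S x v d ↔ weightMap P (v - μ) ∈ normalCone S x ∧ ‖v - μ‖ ≤ d := by
  have hdet : IsUnit P.det := (Matrix.isUnit_iff_isUnit_det _).1 hP.isUnit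
  constructor
  · rintro ⟨w, ⟨⟨η, hη, rfl⟩, hd⟩, rfl⟩
    simp only [sub_sub_cancel]
    refine ⟨?_, by simpa using hd⟩
    rwa [weightMap, Matrix.toEuclideanCLM_toLp, Matrix.mulVec_mulVec, Matrix.mul_nonsing_inv _ hdet,
      Matrix.one_mulVec]
  · rintro ⟨hη, hd⟩
    refine ⟨v - μ, ⟨⟨_, hη, ?_⟩, by simpa using hd⟩, sub_sub_cancel _ _⟩
    simp only [weightMap, Matrix.ofLp_toEuclideanCLM, Matrix.mulVec_mulVec,
      Matrix.nonsing_inv_mul _ hdet, Matrix.one_mulVec]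

lemma inner_weightMap_sub_self (hP : P.IsHermitian) (v μ ν : EuclideanSpace ℝ ι) :
    inner ℝ (ν - v) (weightMap P (ν - v)) = inner ℝ (ν - μ) (weightMap P (ν - μ)) -
      2 * inner ℝ (weightMap P (v - μ)) (ν - μ) + inner ℝ (μ - v) (weightMap P (μ - v)) := by
  have h1 := inner_weightMap_self_add hP (ν - μ) (μ - v)
  have h2 : weightMap P (μ - v) = -weightMap P (v - μ) := by rw [← map_neg, neg_sub]
  rw [sub_add_sub_cancel, h2, inner_neg_right] at h1
  rw [h2, real_inner_comm (ν - μ) (weightMap P (v - μ))]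
  linarith

/-- A tangent vector that is orthogonal to the normal `P (v - μ)` is the projection of `v`; the
tangent cone need not be convex. -/
lemma mem_projOp_of_normal (hP : P.PosSemidef) {S : Set (EuclideanSpace ℝ ι)}
    {x v μ : EuclideanSpace ℝ ι} (hμ : μ ∈ tangentCone S x)
    (hη : weightMap P (v - μ) ∈ normalCone S x) (h0 : inner ℝ μ (weightMap P (v - μ)) = 0) :
    μ ∈ projOp P S x v := by
  refine ⟨hμ, fun ν hν => ?_⟩
  rw [weightedNorm_sq hP, weightedNorm_sq hP, inner_weightMap_sub_self hP.1 v μ ν]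
  have h1 := inner_weightMap_self_nonneg hP (ν - μ)
  have h2 := hη ν hν
  rw [inner_sub_right, real_inner_comm μ, h0]
  linarith

/-- The tangent cone of a regular superlevel set is convex, so the residual of the projection is a
normal. -/
lemma normal_of_mem_projOp (hP : P.PosSemidef) {h : EuclideanSpace ℝ ι → ℝ}
    (hh : ContDiff ℝ 1 h) (h_regular : ∀ x, h x = 0 → gradient h x ≠ 0)
    {x v μ : EuclideanSpace ℝ ι} (hx : 0 ≤ h x) (hμ : μ ∈ projOp P {x | 0 ≤ h x} x v) :
    weightMap P (v - μ) ∈ normalCone {x | 0 ≤ h x} x := by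
  obtain ⟨hμT, hmin⟩ := hμ
  have hd : DifferentiableAt ℝ h x := hh.differentiable one_ne_zero x
  -- First variation along a direction that may be added to `μ`.
  have key : ∀ ν, (∀ s > (0 : ℝ), μ + s • ν ∈ tangentCone {x | 0 ≤ h x} x) →
      inner ℝ (weightMap P (v - μ)) ν ≤ 0 := fun ν hν => by
    have h1 : ∀ s > (0 : ℝ), 2 * inner ℝ (weightMap P (v - μ)) ν ≤
        s * inner ℝ ν (weightMap P ν) := fun s hs => by
      have := hmin _ (hν s hs)
      rw [weightedNorm_sq hP, weightedNorm_sq hP, inner_weightMap_sub_self hP.1 v μ (μ + s • ν),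
        add_sub_cancel_left, map_smul, real_inner_smul_left, real_inner_smul_right,
        real_inner_smul_right] at this
      exact le_of_mul_le_mul_left (by linarith) hs
    have hlim : Tendsto (fun s : ℝ => s * inner ℝ ν (weightMap P ν)) (𝓝[>] 0) (𝓝 0) := by
      have : Continuous fun s : ℝ => s * inner ℝ ν (weightMap P ν) := by fun_prop
      simpa using (this.tendsto 0).mono_left nhdsWithin_le_nhds
    have := ge_of_tendsto hlim (eventually_nhdsWithin_of_forall h1)
    linarith
  intro ν hν
  rcases hx.lt_or_eq with hx | hx
  · exact key ν fun s _ => mem_tangentCone_of_pos hh.continuous hx _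
  -- At a boundary point, tilt `ν` inwards by a small multiple of the gradient.
  have hμ0 := inner_gradient_nonneg_of_mem_tangentCone hd hx.symm hμT
  have hν0 := inner_gradient_nonneg_of_mem_tangentCone hd hx.symm hν
  have ha : 0 < inner ℝ (gradient h x) (gradient h x) :=
    real_inner_self_pos.2 (h_regular x hx.symm)
  have h1 : ∀ r > (0 : ℝ), inner ℝ (weightMap P (v - μ)) (ν + r • gradient h x) ≤ 0 := fun r hr =>
    key _ fun s hs => mem_tangentCone_of_inner_gradient_pos hd hx.le (by
      simp only [inner_add_right, real_inner_smul_right]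
      positivity)
  have hlim : Tendsto (fun r : ℝ => inner ℝ (weightMap P (v - μ)) (ν + r • gradient h x)) (𝓝[>] 0)
      (𝓝 (inner ℝ (weightMap P (v - μ)) ν)) := by
    have : Continuous fun r : ℝ => inner ℝ (weightMap P (v - μ)) (ν + r • gradient h x) := by
      fun_prop
    simpa using (this.tendsto 0).mono_left nhdsWithin_le_nhds
  exact le_of_tendsto hlim (eventually_nhdsWithin_of_forall h1)

end Projection

/-! ### Absolutely continuous functions -/

section AbsCont

lemma absolutelyContinuousOnInterval_comp {X Y : Type*} [PseudoMetricSpace X] [PseudoMetricSpace Y]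
    {u : ℝ → X} {a b : ℝ} {K : NNReal} {F : X → Y} {s : Set X}
    (hF : LipschitzOnWith K F s) (hu : AbsolutelyContinuousOnInterval u a b)
    (hus : MapsTo u (uIcc a b) s) :
    AbsolutelyContinuousOnInterval (fun t => F (u t)) a b := by
  refine squeeze_zero' (.of_forall fun E => Finset.sum_nonneg fun i _ => dist_nonneg) ?_
    (by simpa using Tendsto.const_mul (K : ℝ) hu)
  refine eventually_inf_principal.2 (.of_forall fun E hE => ?_)
  rw [Finset.mul_sum]
  exact Finset.sum_le_sum fun i hi =>
    hF.dist_le_mul _ (hus (hE.1 i hi).1) _ (hus (hE.1 i hi).2)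

/-- Grönwall's inequality in differential form for absolutely continuous functions, with zero
initial value. -/
lemma nonpos_of_ae_hasDerivAt_le {E : ℝ → ℝ} {K T : ℝ}
    (hE : AbsolutelyContinuousOnInterval E 0 T) (hE0 : E 0 = 0)
    (hd : ∀ᵐ t ∂(volume.restrict (Icc 0 T)), ∃ e, HasDerivAt E e t ∧ e ≤ K * E t) :
    ∀ t ∈ Icc 0 T, E t ≤ 0 := by
  intro t ht
  have hexp : AbsolutelyContinuousOnInterval (fun s : ℝ => Real.exp (-K * s)) 0 T :=
    ContDiffOn.absolutelyContinuousOnInterval (by fun_prop)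
  have hF : AbsolutelyContinuousOnInterval (fun s => Real.exp (-K * s) * E s) 0 t := by
    refine (hexp.fun_mul hE).mono ?_
    rw [uIcc_of_le ht.1, uIcc_of_le (ht.1.trans ht.2)]
    exact Icc_subset_Icc_right ht.2
  have hint := hF.integral_deriv_eq_sub
  have hle : 0 ≤ ∫ s in (0 : ℝ)..t, -deriv (fun s => Real.exp (-K * s) * E s) s := by
    refine intervalIntegral.integral_nonneg_of_ae_restrict ht.1 ?_
    filter_upwards [ae_restrict_of_ae_restrict_of_subset (Icc_subset_Icc_right ht.2) hd]
      with s ⟨e, hes, hle⟩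
    have h1 : HasDerivAt (fun s : ℝ => Real.exp (-K * s)) (Real.exp (-K * s) * -K) s := by
      simpa using ((hasDerivAt_id s).const_mul (-K)).exp
    rw [(h1.fun_mul hes).deriv]
    have : 0 < Real.exp (-K * s) := Real.exp_pos _
    simp only [Pi.zero_apply]
    nlinarith
  rw [intervalIntegral.integral_neg, hint] at hle
  simp only [hE0, mul_zero, sub_zero] at hle
  have : 0 < Real.exp (-K * t) := Real.exp_pos _
  by_contra! hpos
  have := mul_pos this hpos
  linarith

end AbsCont

/-! ### The two inclusions and the full normal cone -/

section Solutions

/-- A solution constrained to a closed set almost everywhere stays there near every interior time,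
so at almost every time the constraint holds on both sides. -/
lemma ae_eventually_mem {X : Type*} [NormedAddCommGroup X] {C : Set X} (hC : IsClosed C)
    {T : ℝ} {φ : ℝ → X} (hφ : AbsolutelyContinuousOnInterval φ 0 T)
    (h : ∀ᵐ t ∂(volume.restrict (Icc 0 T)), φ t ∈ C) :
    ∀ᵐ t ∂(volume.restrict (Icc 0 T)), Icc 0 T ∈ 𝓝 t ∧ ∀ᶠ s in 𝓝 t, φ s ∈ C := by
  rw [← Measure.restrict_congr_set (Ioo_ae_eq_Icc (μ := volume))] at h ⊢
  filter_upwards [ae_restrict_mem measurableSet_Ioo] with t ht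
  refine ⟨Icc_mem_nhds ht.1 ht.2, ?_⟩
  filter_upwards [Ioo_mem_nhds ht.1 ht.2] with s hs
  by_contra hsC
  have hcont : ContinuousOn φ (Ioo 0 T) :=
    hφ.continuousOn.mono fun r hr => by
      rw [uIcc_of_le (hr.1.trans hr.2).le]
      exact Ioo_subset_Icc_self hr
  have hopen : IsOpen (Ioo 0 T ∩ φ ⁻¹' Cᶜ) :=
    hcont.isOpen_inter_preimage isOpen_Ioo hC.isOpen_compl
  refine (hopen.measure_pos volume ⟨s, hs, hsC⟩).ne' ?_
  have h' := (ae_restrict_iff' measurableSet_Ioo).1 h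
  refine measure_mono_null (fun r hr => ?_) (mem_ae_iff.1 h')
  simpa [and_assoc] using hr

variable {m n : ℕ} {P : Matrix (Fin n) (Fin n) ℝ} {S : Set (EuclideanSpace ℝ (Fin n))}
  {f : EuclideanSpace ℝ (Fin m) × EuclideanSpace ℝ (Fin n) → EuclideanSpace ℝ (Fin n)}
  {g : EuclideanSpace ℝ (Fin m) × EuclideanSpace ℝ (Fin n) → EuclideanSpace ℝ (Fin m)}
  {w₀ : EuclideanSpace ℝ (Fin m) × EuclideanSpace ℝ (Fin n)} {T : ℝ}
  {φ ψ : ℝ → EuclideanSpace ℝ (Fin m) × EuclideanSpace ℝ (Fin n)}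

/-- The right-hand side `[g(z, x); f(z, x) - P⁻¹ N_S(x)]` with the whole normal cone. It is written
in terms of `P`, which avoids the matrix inverse. -/
def fullNormalConeField (P : Matrix (Fin n) (Fin n) ℝ) (S : Set (EuclideanSpace ℝ (Fin n)))
    (g : EuclideanSpace ℝ (Fin m) × EuclideanSpace ℝ (Fin n) → EuclideanSpace ℝ (Fin m))
    (f : EuclideanSpace ℝ (Fin m) × EuclideanSpace ℝ (Fin n) → EuclideanSpace ℝ (Fin n))
    (w : EuclideanSpace ℝ (Fin m) × EuclideanSpace ℝ (Fin n)) :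
    Set (EuclideanSpace ℝ (Fin m) × EuclideanSpace ℝ (Fin n)) :=
  {g w} ×ˢ {μ | weightMap P (f w - μ) ∈ normalCone S w.2}

/-- Along a curve in `ℝᵐ × S` the normal part of the field is orthogonal to the velocity. -/
lemma inner_snd_eq_zero {t : ℝ} {v : EuclideanSpace ℝ (Fin m) × EuclideanSpace ℝ (Fin n)}
    {η : EuclideanSpace ℝ (Fin n)}
    (hφ : ∀ᶠ s in 𝓝 t, φ s ∈ univ ×ˢ S) (hv : HasDerivAt φ v t)
    (hη : η ∈ normalCone S (φ t).2) : inner ℝ v.2 η = 0 :=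
  inner_eq_zero_of_hasDerivAt (c := fun s => (φ s).2) hv.snd (hφ.mono fun _ hs => hs.2) hη

/-- At almost every time the velocity is tangent on both sides, so minimality of the projection is
equivalent to the residual being a normal. -/
lemma isPDSSolution_iff (hP : P.PosDef) {h : EuclideanSpace ℝ (Fin n) → ℝ} (hh : ContDiff ℝ 1 h)
    (h_regular : ∀ x, h x = 0 → gradient h x ≠ 0) :
    IsPDSSolution P (safeSet h) g f w₀ T φ ↔
      IsSolution (fullNormalConeField P (safeSet h) g f) (univ ×ˢ safeSet h) w₀ T φ := by
  have hS : IsClosed (safeSet h) := isClosed_le continuous_const hh.continuous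
  constructor
  · rintro ⟨hac, h0, hae⟩
    refine ⟨hac, h0, hae.mono ?_⟩
    rintro t ⟨-, v, hv, hd⟩
    rw [pdsField_eq hP.posSemidef] at hv
    have hmem : (φ t).2 ∈ safeSet h := hS.closure_subset (mem_closure_of_mem_tangentCone hv.2.1)
    exact ⟨⟨trivial, hmem⟩, v, ⟨hv.1, normal_of_mem_projOp hP.posSemidef hh h_regular hmem hv.2⟩,
      hd⟩
  · rintro ⟨hac, h0, hae⟩
    refine ⟨hac, h0, ?_⟩
    filter_upwards [hae, ae_eventually_mem (isClosed_univ.prod hS) hac (hae.mono fun t ht => ht.1)]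
      with t ⟨_, v, hv, hd⟩ ⟨hnhds, hev⟩
    have hd' := hd.hasDerivAt hnhds
    refine ⟨trivial, v, ?_, hd⟩
    rw [pdsField_eq hP.posSemidef]
    refine ⟨hv.1, mem_projOp_of_normal hP.posSemidef ?_ hv.2 (inner_snd_eq_zero hev hd' hv.2)⟩
    exact mem_tangentCone_of_hasDerivAt (c := fun s => (φ s).2) hd'.snd
      ((hev.mono fun _ hs => hs.2).filter_mono nhdsWithin_le_nhds)

lemma IsNormalConeSolution.isSolution_full (hP : P.PosDef) {d : ℝ}
    (hφ : IsNormalConeSolution P S g f d w₀ T φ) :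
    IsSolution (fullNormalConeField P S g f) (univ ×ˢ S) w₀ T φ := by
  obtain ⟨hac, h0, hae⟩ := hφ
  refine ⟨hac, h0, hae.mono ?_⟩
  rintro t ⟨hmem, v, hv, hd⟩
  exact ⟨hmem, v, ⟨hv.1, ((mem_truncNormalMap_iff hP).1 hv.2).1⟩, hd⟩

/-- Orthogonality to the velocity bounds the normal part of the field, so truncating the normal
cone at a large enough radius loses no solutions. -/
lemma isNormalConeSolution_of_full [NeZero n] (hP : P.PosDef) (hS : IsClosed S) {d : ℝ}
    (hd : ∀ t ∈ Icc 0 T, lambdaMax P / lambdaMin P * ‖f (φ t)‖ ≤ d)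
    (hφ : IsSolution (fullNormalConeField P S g f) (univ ×ˢ S) w₀ T φ) :
    IsNormalConeSolution P S g f d w₀ T φ := by
  obtain ⟨hac, h0, hae⟩ := hφ
  refine ⟨hac, h0, ?_⟩
  filter_upwards [hae, ae_eventually_mem (isClosed_univ.prod hS) hac (hae.mono fun t ht => ht.1),
    ae_restrict_mem measurableSet_Icc] with t ⟨hmem, v, hv, hd'⟩ ⟨hnhds, hev⟩ ht
  refine ⟨hmem, v, ⟨hv.1, (mem_truncNormalMap_iff hP).2 ⟨hv.2, ?_⟩⟩, hd'⟩
  exact (norm_sub_le_of_inner_eq_zero hP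
    (inner_snd_eq_zero hev (hd'.hasDerivAt hnhds) hv.2)).trans (hd t ht)

end Solutions

/-! ### Uniqueness -/

section Uniqueness

variable {m n : ℕ} {P : Matrix (Fin n) (Fin n) ℝ}
  {f : EuclideanSpace ℝ (Fin m) × EuclideanSpace ℝ (Fin n) → EuclideanSpace ℝ (Fin n)}
  {g : EuclideanSpace ℝ (Fin m) × EuclideanSpace ℝ (Fin n) → EuclideanSpace ℝ (Fin m)}
  {w₀ : EuclideanSpace ℝ (Fin m) × EuclideanSpace ℝ (Fin n)} {T : ℝ}
  {φ ψ : ℝ → EuclideanSpace ℝ (Fin m) × EuclideanSpace ℝ (Fin n)}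

/-- The squared `diag(I, P)`-norm of `(z, x)`, the Lyapunov function for the difference of two
solutions. -/
noncomputable def blockEnergy (P : Matrix (Fin n) (Fin n) ℝ)
    (w : EuclideanSpace ℝ (Fin m) × EuclideanSpace ℝ (Fin n)) : ℝ :=
  inner ℝ w.1 w.1 + inner ℝ w.2 (weightMap P w.2)

lemma min_mul_norm_sq_le_blockEnergy (hP : P.IsHermitian) (hpos : 0 ≤ lambdaMin P)
    (w : EuclideanSpace ℝ (Fin m) × EuclideanSpace ℝ (Fin n)) :
    min 1 (lambdaMin P) * ‖w‖ ^ 2 ≤ blockEnergy P w := by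
  have h1 := lambdaMin_mul_norm_sq_le hP w.2
  have h2 : inner ℝ w.1 w.1 = ‖w.1‖ ^ 2 := real_inner_self_eq_norm_sq _
  have h3 : min 1 (lambdaMin P) * ‖w.1‖ ^ 2 ≤ 1 * ‖w.1‖ ^ 2 := by gcongr; exact min_le_left _ _
  have h4 : min 1 (lambdaMin P) * ‖w.2‖ ^ 2 ≤ lambdaMin P * ‖w.2‖ ^ 2 := by
    gcongr; exact min_le_right _ _
  have h5 : 0 ≤ lambdaMin P * ‖w.2‖ ^ 2 := by positivity
  rw [blockEnergy, h2]
  rcases max_choice ‖w.1‖ ‖w.2‖ with h | h <;> rw [Prod.norm_def, h] <;>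
    nlinarith [sq_nonneg ‖w.1‖]

lemma contDiff_blockEnergy : ContDiff ℝ 1 (blockEnergy (m := m) P) := by
  unfold blockEnergy
  exact (contDiff_fst.inner ℝ contDiff_fst).add
    (contDiff_snd.inner ℝ ((weightMap P).contDiff.comp contDiff_snd))

lemma hasDerivAt_blockEnergy (hP : P.IsHermitian)
    {u : ℝ → EuclideanSpace ℝ (Fin m) × EuclideanSpace ℝ (Fin n)}
    {v : EuclideanSpace ℝ (Fin m) × EuclideanSpace ℝ (Fin n)} {t : ℝ} (hu : HasDerivAt u v t) :
    HasDerivAt (fun s => blockEnergy P (u s))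
      (2 * inner ℝ (u t).1 v.1 + 2 * inner ℝ (u t).2 (weightMap P v.2)) t := by
  have h1 : HasDerivAt (fun s => (u s).1) v.1 t := hu.fst
  have h2 : HasDerivAt (fun s => (u s).2) v.2 t := hu.snd
  have h3 := (h1.inner ℝ h1).add
    (h2.inner ℝ ((weightMap P).hasFDerivAt.comp_hasDerivAt t h2))
  refine h3.congr_deriv ?_
  have h4 : inner ℝ v.2 (weightMap P (u t).2) = inner ℝ (u t).2 (weightMap P v.2) := by
    rw [inner_weightMap_comm hP, real_inner_comm]
  have h5 : inner ℝ v.1 (u t).1 = inner ℝ (u t).1 v.1 := real_inner_comm _ _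
  simp only [Function.comp_apply]
  rw [h4, h5]
  ring

/-- Pointwise dissipation estimate: hypomonotonicity of the normal cones makes the velocity field
of the inclusion one-sided Lipschitz in the energy inner product. -/
lemma two_mul_inner_sub_le {S : Set (EuclideanSpace ℝ (Fin n))} {c B : ℝ}
    (hc : ∀ x ∈ S, ∀ y ∈ S, ∀ η ∈ normalCone S x, inner ℝ η (y - x) ≤ c * ‖η‖ * ‖y - x‖ ^ 2)
    (hc0 : 0 ≤ c) {Kf Kg : NNReal}
    {s : Set (EuclideanSpace ℝ (Fin m) × EuclideanSpace ℝ (Fin n))}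
    (hf : LipschitzOnWith Kf f s) (hg : LipschitzOnWith Kg g s)
    {w w' v v' : EuclideanSpace ℝ (Fin m) × EuclideanSpace ℝ (Fin n)}
    (hw : w ∈ s) (hw' : w' ∈ s) (hwS : w.2 ∈ S) (hwS' : w'.2 ∈ S)
    (hv : v ∈ fullNormalConeField P S g f w) (hv' : v' ∈ fullNormalConeField P S g f w')
    (hB : ‖f w - v.2‖ ≤ B) (hB' : ‖f w' - v'.2‖ ≤ B) :
    2 * inner ℝ (w - w').1 (v - v').1 + 2 * inner ℝ (w - w').2 (weightMap P (v - v').2) ≤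
      2 * (Kg + ‖weightMap P‖ * Kf + 2 * (c * (‖weightMap P‖ * B))) * ‖w - w'‖ ^ 2 := by
  set A := weightMap P
  have hn1 : ‖(w - w').1‖ ≤ ‖w - w'‖ := norm_fst_le _
  have hn2 : ‖(w - w').2‖ ≤ ‖w - w'‖ := norm_snd_le _
  have hz : inner ℝ (w - w').1 (v - v').1 ≤ Kg * ‖w - w'‖ ^ 2 := by
    have e1 : v.1 = g w := hv.1
    have e2 : v'.1 = g w' := hv'.1
    calc inner ℝ (w - w').1 (v - v').1 ≤ ‖(w - w').1‖ * ‖(v - v').1‖ := real_inner_le_norm _ _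
      _ ≤ ‖w - w'‖ * (Kg * ‖w - w'‖) := by
        gcongr
        rw [Prod.fst_sub, e1, e2]
        exact hg.norm_sub_le hw hw'
      _ = Kg * ‖w - w'‖ ^ 2 := by ring
  have hx : inner ℝ (w - w').2 (A (f w - f w')) ≤ ‖A‖ * Kf * ‖w - w'‖ ^ 2 :=
    calc inner ℝ (w - w').2 (A (f w - f w')) ≤ ‖(w - w').2‖ * ‖A (f w - f w')‖ :=
          real_inner_le_norm _ _
      _ ≤ ‖w - w'‖ * (‖A‖ * (Kf * ‖w - w'‖)) := by
        gcongr
        exact (A.le_opNorm _).trans (by gcongr; exact hf.norm_sub_le hw hw')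
      _ = ‖A‖ * Kf * ‖w - w'‖ ^ 2 := by ring
  have key : ∀ {a b p : EuclideanSpace ℝ (Fin m) × EuclideanSpace ℝ (Fin n)}, a.2 ∈ S → b.2 ∈ S →
      A (f a - p.2) ∈ normalCone S a.2 → ‖f a - p.2‖ ≤ B →
      inner ℝ (A (f a - p.2)) (b.2 - a.2) ≤ c * (‖A‖ * B) * ‖a - b‖ ^ 2 := by
    intro a b p ha hb hp hpB
    have hB0 : 0 ≤ B := (norm_nonneg _).trans hpB
    refine (hc _ ha _ hb _ hp).trans ?_
    have e1 : ‖b.2 - a.2‖ ≤ ‖a - b‖ := by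
      rw [norm_sub_rev]
      exact norm_snd_le (a - b)
    have e2 : ‖A (f a - p.2)‖ ≤ ‖A‖ * B := (A.le_opNorm _).trans (by gcongr)
    gcongr
  have hk := key hwS hwS' hv.2 hB
  have hk' := key hwS' hwS hv'.2 hB'
  rw [norm_sub_rev w' w] at hk'
  have hsplit : inner ℝ (w - w').2 (A (v - v').2) = inner ℝ (w - w').2 (A (f w - f w')) +
      inner ℝ (A (f w - v.2)) (w'.2 - w.2) + inner ℝ (A (f w' - v'.2)) (w.2 - w'.2) := by
    rw [real_inner_comm (w'.2 - w.2), real_inner_comm (w.2 - w'.2), ← neg_sub w.2 w'.2,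
      inner_neg_left, ← inner_neg_right, ← map_neg, Prod.snd_sub, ← inner_add_right,
      ← inner_add_right, ← map_add, ← map_add]
    congr 2
    rw [Prod.snd_sub]
    abel
  rw [hsplit]
  linarith

/-- Two solutions of the inclusion with the whole normal cone and the same initial value agree; they
are not assumed to stay in `Z × S`, since each has its own compact range. -/
theorem eqOn_of_isSolution_full [NeZero n] (hP : P.PosDef) {h : EuclideanSpace ℝ (Fin n) → ℝ}
    (hh : ContDiff ℝ 1 h) (h_grad : LocallyLipschitz (gradient h))
    (h_regular : ∀ x, h x = 0 → gradient h x ≠ 0) (hS : IsCompact (safeSet h))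
    (hf : LocallyLipschitz f) (hg : LocallyLipschitz g)
    (hφ : IsSolution (fullNormalConeField P (safeSet h) g f) (univ ×ˢ safeSet h) w₀ T φ)
    (hψ : IsSolution (fullNormalConeField P (safeSet h) g f) (univ ×ˢ safeSet h) w₀ T ψ) :
    EqOn ψ φ (Icc 0 T) := by
  intro t₀ ht₀
  have hT : 0 ≤ T := ht₀.1.trans ht₀.2
  obtain ⟨hφac, hφ0, hφae⟩ := hφ
  obtain ⟨hψac, hψ0, hψae⟩ := hψ
  have hIcc : uIcc 0 T = Icc 0 T := uIcc_of_le hT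
  have hφc : ContinuousOn φ (Icc 0 T) := hIcc ▸ hφac.continuousOn
  have hψc : ContinuousOn ψ (Icc 0 T) := hIcc ▸ hψac.continuousOn
  -- Both solutions live in a compact set, on which the data are bounded and Lipschitz.
  have hs : IsCompact (φ '' Icc 0 T ∪ ψ '' Icc 0 T) :=
    (isCompact_Icc.image_of_continuousOn hφc).union (isCompact_Icc.image_of_continuousOn hψc)
  set s := φ '' Icc 0 T ∪ ψ '' Icc 0 T
  obtain ⟨Kf, hKf⟩ := hf.locallyLipschitzOn.exists_lipschitzOnWith_of_compact hs
  obtain ⟨Kg, hKg⟩ := hg.locallyLipschitzOn.exists_lipschitzOnWith_of_compact hs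
  obtain ⟨F, hF⟩ := hs.exists_bound_of_continuousOn hf.continuous.continuousOn
  obtain ⟨c, hc0, hc⟩ := exists_inner_normal_le hh h_grad h_regular hS
  have hSc : IsClosed (univ ×ˢ safeSet h : Set (EuclideanSpace ℝ (Fin m) × _)) :=
    isClosed_univ.prod hS.isClosed
  have hlam := lambdaMin_pos hP
  set κ := lambdaMax P / lambdaMin P
  have hκ : 0 ≤ κ := div_nonneg (hlam.le.trans (lambdaMin_le_lambdaMax hP.1)) hlam.le
  set C := 2 * (Kg + ‖weightMap P‖ * Kf + 2 * (c * (‖weightMap P‖ * (κ * F))))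
  have hF0 : 0 ≤ F := (norm_nonneg _).trans (hF _ (.inl ⟨t₀, ht₀, rfl⟩))
  have hC0 : 0 ≤ C := by positivity
  have hmin : 0 < min 1 (lambdaMin P) := lt_min one_pos hlam
  have hac : AbsolutelyContinuousOnInterval (fun t => blockEnergy P (φ t - ψ t)) 0 T := by
    have himg : IsCompact ((fun t => φ t - ψ t) '' uIcc 0 T) :=
      isCompact_uIcc.image_of_continuousOn (hIcc ▸ hφc.sub hψc)
    obtain ⟨K, hK⟩ := (contDiff_blockEnergy (P := P)
      (m := m)).locallyLipschitz.locallyLipschitzOn.exists_lipschitzOnWith_of_compact himg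
    exact absolutelyContinuousOnInterval_comp hK (hφac.fun_sub hψac) (mapsTo_image _ _)
  have hle := nonpos_of_ae_hasDerivAt_le (K := C / min 1 (lambdaMin P)) hac
    (by simp [hφ0, hψ0, blockEnergy]) (by
      filter_upwards [hφae, hψae, ae_restrict_mem measurableSet_Icc,
        ae_eventually_mem hSc hφac (hφae.mono fun t ht => ht.1),
        ae_eventually_mem hSc hψac (hψae.mono fun t ht => ht.1)]
        with t ⟨hφS, v, hv, hvd⟩ ⟨hψS, v', hv', hvd'⟩ ht ⟨hnhds, hφev⟩ ⟨_, hψev⟩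
      have hvd := hvd.hasDerivAt hnhds
      have hvd' := hvd'.hasDerivAt hnhds
      have hφs : φ t ∈ s := .inl ⟨t, ht, rfl⟩
      have hψs : ψ t ∈ s := .inr ⟨t, ht, rfl⟩
      refine ⟨_, hasDerivAt_blockEnergy hP.1 (hvd.sub hvd'), ?_⟩
      refine (two_mul_inner_sub_le (B := κ * F) hc hc0 hKf hKg hφs hψs hφS.2 hψS.2 hv hv'
        ((norm_sub_le_of_inner_eq_zero hP (inner_snd_eq_zero hφev hvd hv.2)).trans ?_)
        ((norm_sub_le_of_inner_eq_zero hP (inner_snd_eq_zero hψev hvd' hv'.2)).trans ?_)).trans ?_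
      · gcongr
        exact hF _ hφs
      · gcongr
        exact hF _ hψs
      · have := min_mul_norm_sq_le_blockEnergy hP.1 hlam.le (φ t - ψ t)
        refine (le_of_eq ?_).trans (mul_le_mul_of_nonneg_left this (div_nonneg hC0 hmin.le))
        rw [← mul_assoc (C / _), div_mul_cancel₀ _ hmin.ne'])
  have h1 := (min_mul_norm_sq_le_blockEnergy hP.1 hlam.le (φ t₀ - ψ t₀)).trans (hle t₀ ht₀)
  have h2 : ‖φ t₀ - ψ t₀‖ ^ 2 ≤ 0 := nonpos_of_mul_nonpos_right h1 hmin
  have h3 : ‖φ t₀ - ψ t₀‖ = 0 := pow_eq_zero_iff two_ne_zero |>.1 (h2.antisymm (sq_nonneg _))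
  exact (sub_eq_zero.1 (norm_eq_zero.1 h3)).symm

end Uniqueness

/-! ### The truncation radius -/

section Radius

lemma IsKInfty.nonneg {γ : ℝ → ℝ} (hγ : IsKInfty γ) {a : ℝ} (ha : 0 ≤ a) : 0 ≤ γ a := by
  simpa [hγ.map_zero] using hγ.strictMonoOn.monotoneOn (mem_Ici.2 le_rfl) (mem_Ici.2 ha) ha

lemma IsKInfty.invFunOn_nonneg {γ : ℝ → ℝ} (hγ : IsKInfty γ) {b : ℝ} (hb : 0 ≤ b) :
    0 ≤ Function.invFunOn γ (Ici 0) b := by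
  obtain ⟨a, ha0, hab⟩ :=
    ((hγ.tendsto_atTop.eventually_ge_atTop b).and (eventually_ge_atTop 0)).exists
  have hsurj : b ∈ γ '' Icc 0 a :=
    intermediate_value_Icc hab (hγ.continuousOn.mono Icc_subset_Ici_self)
      ⟨by rwa [hγ.map_zero], ha0⟩
  obtain ⟨a', ha', rfl⟩ := hsurj
  exact Function.invFunOn_mem ⟨a', ha'.1, rfl⟩

variable {m n : ℕ} {P : Matrix (Fin n) (Fin n) ℝ}
  {f : EuclideanSpace ℝ (Fin m) × EuclideanSpace ℝ (Fin n) → EuclideanSpace ℝ (Fin n)}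
  {h : EuclideanSpace ℝ (Fin n) → ℝ} {Z : Set (EuclideanSpace ℝ (Fin m))} {γ : ℝ → ℝ} {ε : ℝ}

lemma neZero_of_minBoundaryGrad_pos (hM : 0 < minBoundaryGrad h) : NeZero n := by
  refine ⟨fun hn => hM.ne' ?_⟩
  subst hn
  -- In dimension zero every set is clopen, so the boundary is empty and `M₁ = sInf ∅ = 0`.
  simp [minBoundaryGrad]

lemma alphaStar_nonneg (hγ : IsKInfty γ) (hε : ε < minBoundaryGrad h) (L : NNReal) :
    0 ≤ alphaStar f h Z γ L ε := by
  refine div_nonneg (Real.sSup_nonneg ?_)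
    (hγ.invFunOn_nonneg (div_nonneg (sub_nonneg.2 hε.le) L.2))
  rintro _ ⟨w, -, rfl⟩
  exact abs_nonneg _

/-- The factor `1 + L γ(·) / M₁` in the radius is at least one, so the radius dominates the a priori
bound on the normal part of the field. -/
lemma mul_norm_le_deltaBound [NeZero n] (hP : P.PosDef) (hf : Continuous f)
    (h_grad : Continuous (gradient h)) (hZ : IsCompact Z) (hS : IsCompact (safeSet h))
    (hγ : IsKInfty γ) (L : NNReal) (hε_pos : 0 < ε) (hε : ε < minBoundaryGrad h)
    {w : EuclideanSpace ℝ (Fin m) × EuclideanSpace ℝ (Fin n)} (hw : w ∈ Z ×ˢ safeSet h) :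
    lambdaMax P / lambdaMin P * ‖f w‖ ≤ deltaBound P f h Z γ L ε := by
  have hα := alphaStar_nonneg (f := f) (Z := Z) hγ hε L
  set α := alphaStar f h Z γ L ε with hα_def
  have hM : 0 < minBoundaryGrad h := hε_pos.trans hε
  have hlam := lambdaMin_pos hP
  have hκ : 0 ≤ lambdaMax P / lambdaMin P :=
    div_nonneg (hlam.le.trans (lambdaMin_le_lambdaMax hP.1)) hlam.le
  have harg : ∀ w, 0 ≤ 1 / α * |lieDeriv f h w| := fun w => by positivity
  have hlie : Continuous (lieDeriv f h) := by
    unfold lieDeriv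
    fun_prop
  have hγc : Continuous fun w => γ (1 / α * |lieDeriv f h w|) :=
    hγ.continuousOn.comp_continuous (by fun_prop) harg
  have hcont : Continuous fun w => (1 + L * γ (1 / α * |lieDeriv f h w|) / minBoundaryGrad h) *
      (lambdaMax P / lambdaMin P) * ‖f w‖ :=
    ((continuous_const.add ((continuous_const.mul hγc).div_const _)).mul continuous_const).mul
      hf.norm
  refine le_trans ?_ (le_csSup ((hZ.prod hS).image hcont).bddAbove ⟨w, hw, rfl⟩)
  have hγ0 := hγ.nonneg (harg w)
  have h1 : 0 ≤ L * γ (1 / α * |lieDeriv f h w|) / minBoundaryGrad h := by positivity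
  have h2 : 0 ≤ lambdaMax P / lambdaMin P * ‖f w‖ := by positivity
  simp only [mul_assoc]
  exact le_mul_of_one_le_left h2 (by linarith)

end Radius

end ProjDyn

theorem mainTheorem5 {m n : ℕ}
    (P : Matrix (Fin n) (Fin n) ℝ) (hP : P.PosDef)
    (f : EuclideanSpace ℝ (Fin m) × EuclideanSpace ℝ (Fin n) → EuclideanSpace ℝ (Fin n))
    (hf : LocallyLipschitz f)
    (g : EuclideanSpace ℝ (Fin m) × EuclideanSpace ℝ (Fin n) → EuclideanSpace ℝ (Fin m))
    (Z : Set (EuclideanSpace ℝ (Fin m))) (hZ : IsCompact Z)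
    (h : EuclideanSpace ℝ (Fin n) → ℝ)
    (hS_nonempty : (ProjDyn.safeSet h).Nonempty) (hS_compact : IsCompact (ProjDyn.safeSet h))
    (h_C1 : ContDiff ℝ 1 h) (h_grad : LocallyLipschitz (gradient h))
    (L : NNReal) (hL : LipschitzOnWith L (gradient h) (ProjDyn.safeSet h))
    (h_regular : ∀ x, h x = 0 → gradient h x ≠ 0)
    (γ : ℝ → ℝ) (hγ : ProjDyn.IsKInfty γ)
    (hγ_dist : ∀ x ∈ ProjDyn.safeSet h,
      Metric.infDist x (frontier (ProjDyn.safeSet h)) ≤ γ (h x))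
    (ε : ℝ) (hε_pos : 0 < ε) (hε_lt : ε < ProjDyn.minBoundaryGrad h)
    (z₀ : EuclideanSpace ℝ (Fin m)) (hz₀ : z₀ ∈ Z)
    (x₀ : EuclideanSpace ℝ (Fin n)) (hx₀ : x₀ ∈ ProjDyn.safeSet h)
    (T : ℝ) (hT : 0 ≤ T)
    (φ : ℝ → EuclideanSpace ℝ (Fin m) × EuclideanSpace ℝ (Fin n)) (hφ₀ : φ 0 = (z₀, x₀))
    (hφ : ∀ t ∈ Set.Icc 0 T, φ t ∈ Z ×ˢ ProjDyn.safeSet h) :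
    (Continuous g →
      (ProjDyn.IsPDSSolution P (ProjDyn.safeSet h) g f (z₀, x₀) T φ ↔
        ProjDyn.IsNormalConeSolution P (ProjDyn.safeSet h) g f
          (ProjDyn.deltaBound P f h Z γ L ε) (z₀, x₀) T φ)) ∧
    (LocallyLipschitz g →
      ProjDyn.IsPDSSolution P (ProjDyn.safeSet h) g f (z₀, x₀) T φ →
        ProjDyn.IsNormalConeSolution P (ProjDyn.safeSet h) g f
          (ProjDyn.deltaBound P f h Z γ L ε) (z₀, x₀) T φ ∧
        (∀ ψ : ℝ → EuclideanSpace ℝ (Fin m) × EuclideanSpace ℝ (Fin n),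
          ProjDyn.IsPDSSolution P (ProjDyn.safeSet h) g f (z₀, x₀) T ψ →
            Set.EqOn ψ φ (Set.Icc 0 T)) ∧
        (∀ ψ : ℝ → EuclideanSpace ℝ (Fin m) × EuclideanSpace ℝ (Fin n),
          ProjDyn.IsNormalConeSolution P (ProjDyn.safeSet h) g f
            (ProjDyn.deltaBound P f h Z γ L ε) (z₀, x₀) T ψ →
              Set.EqOn ψ φ (Set.Icc 0 T))) := by
  have : NeZero n := ProjDyn.neZero_of_minBoundaryGrad_pos (hε_pos.trans hε_lt)
  have hbound : ∀ t ∈ Icc 0 T, ProjDyn.lambdaMax P / ProjDyn.lambdaMin P * ‖f (φ t)‖ ≤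
      ProjDyn.deltaBound P f h Z γ L ε := fun t ht =>
    ProjDyn.mul_norm_le_deltaBound hP hf.continuous h_grad.continuous hZ hS_compact hγ L hε_pos
      hε_lt (hφ t ht)
  have hiff : ∀ {ψ}, ProjDyn.IsPDSSolution P (ProjDyn.safeSet h) g f (z₀, x₀) T ψ ↔ _ :=
    ProjDyn.isPDSSolution_iff hP h_C1 h_regular
  have htrunc := ProjDyn.isNormalConeSolution_of_full (w₀ := (z₀, x₀)) (g := g) hP
    hS_compact.isClosed hbound
  refine ⟨fun _ => ⟨fun hpds => htrunc (hiff.1 hpds), fun hdi => hiff.2 (hdi.isSolution_full hP)⟩,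
    fun hg hpds => ⟨htrunc (hiff.1 hpds), fun ψ hψ => ?_, fun ψ hψ => ?_⟩⟩
  · exact ProjDyn.eqOn_of_isSolution_full hP h_C1 h_grad h_regular hS_compact hf hg (hiff.1 hpds)
      (hiff.1 hψ)
  · exact ProjDyn.eqOn_of_isSolution_full hP h_C1 h_grad h_regular hS_compact hf hg (hiff.1 hpds)
      (hψ.isSolution_full hP)
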